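/- Let $R$ be an associative ring with identity (not necessarily commutative), let $U(R)$ be its set of units, $J(R)$ its Jacobson radical, and $\Delta(R)=\{r\in R : r+u\in U(R)\text{ for all }u\in U(R)\}$. Call $R$ a $W\Delta U$-ring if $U(R)=\pm 1+\Delta(R)$, that is, $U(R)=(1+\Delta(R))\cup(-1+\Delta(R))$. Then the following three statements are equivalent: (1) $R$ is a semi-regular $W\Delta U$-ring; (2) $R$ is an exchange $W\Delta U$-ring; (3) $R$ is a semi-weakly Boolean ring. Here $R$ is semi-regular if $R/J(R)$ is von Neumann regular (every $a$ satisfies $axa=a$ for some $x$) and idempotents lift modulo $J(R)$; $R$ is exchange if for every $a\in R$ there is an idempotent $e\in aR$ with $1-e\in(1-a)R$; and $R$ is semi-weakly Boolean if $R/J(R)$ is weakly Boolean (for every element $a$, either $a$ or $-a$ is idempotent) and idempotents lift modulo $J(R)$. -/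

import Mathlib

namespace WDU

universe u

/-- `Δ(R) = {r ∈ R : r + U(R) ⊆ U(R)}`. This is the largest Jacobson radical (non-unital) subring
of `R` that is closed under multiplication by units of `R`. -/
def Delta (R : Type u) [Ring R] : Set R :=
  {r | ∀ v : R, IsUnit v → IsUnit (r + v)}

/-- `R` is a `WΔU`-ring: `U(R) = ±1 + Δ(R)`, as an equality of subsets of `R`. -/
def IsWDeltaU (R : Type u) [Ring R] : Prop :=
  {x : R | IsUnit x} = {x : R | ∃ d ∈ Delta R, x = 1 + d ∨ x = -1 + d}

/-- `R` is (von Neumann) regular: every `a` satisfies `a x a = a` for some `x`. -/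
def IsRegularRing (R : Type u) [Ring R] : Prop :=
  ∀ a : R, ∃ x : R, a * x * a = a

/-- Idempotents lift modulo `J(R)`: every idempotent of `R / J(R)` is the image of an
idempotent of `R`. -/
def IdempotentsLiftModJacobson (R : Type u) [Ring R] : Prop :=
  ∀ x : R ⧸ Ring.jacobson R, IsIdempotentElem x →
    ∃ e : R, IsIdempotentElem e ∧ Ideal.Quotient.mk (Ring.jacobson R) e = x

/-- `R` is semi-regular: `R / J(R)` is regular and idempotents lift modulo `J(R)`. -/
def IsSemiregularRing (R : Type u) [Ring R] : Prop :=
  IsRegularRing (R ⧸ Ring.jacobson R) ∧ IdempotentsLiftModJacobson R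

/-- `R` is exchange: for every `a` there is an idempotent `e ∈ aR` with `1 - e ∈ (1 - a)R`. -/
def IsExchangeRing (R : Type u) [Ring R] : Prop :=
  ∀ a : R, ∃ e : R, IsIdempotentElem e ∧ (∃ r : R, e = a * r) ∧ ∃ s : R, 1 - e = (1 - a) * s

/-- `R` is weakly Boolean: for every `a`, either `a` or `-a` is idempotent. -/
def IsWeaklyBoolean (R : Type u) [Ring R] : Prop :=
  ∀ a : R, IsIdempotentElem a ∨ IsIdempotentElem (-a)

/-- `R` is semi-weakly Boolean: `R / J(R)` is weakly Boolean and idempotents lift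
modulo `J(R)`. -/
def IsSemiWeaklyBoolean (R : Type u) [Ring R] : Prop :=
  IsWeaklyBoolean (R ⧸ Ring.jacobson R) ∧ IdempotentsLiftModJacobson R

end WDU

namespace WDU

/-! ### Closure properties of Δ. -/

section Delta

variable {S : Type*} [Ring S]

/-! Pass to S = R/J(R), which inherits WΔU. If S is regular or R is exchange, every nonzero right
ideal of S contains a nonzero idempotent. Square-zero elements then lie in Δ(S), which is
multiplicatively closed and has no nonzero idempotent; so S is reduced and its idempotents are
central (`IsIdempotentElem.central`). Elements of Δ(S) are not invertible in nonzero corners, so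
Δ(S) = 0 and the units are ±1. The exchange property then writes each a as -e or 2 - e, which forces
weak Booleanness.

Conversely, units of a weakly Boolean quotient are ±1 and J ⊆ Δ, giving WΔU; the exchange property
lifts along J. -/

theorem IsIdempotentElem.isUnit_one_sub_two_mul {e : S} (he : IsIdempotentElem e) :
    IsUnit (1 - 2 * e) := by
  have he' : e * e = e := he
  have h : (1 - 2 * e) * (1 - 2 * e) = 1 := by
    have : (1 - 2 * e) * (1 - 2 * e) = 1 - 4 * e + 4 * (e * e) := by noncomm_ring
    rw [this, he']; noncomm_ring
  exact ⟨⟨_, _, h, h⟩, rfl⟩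

theorem Delta.neg_mem {a : S} (ha : a ∈ Delta S) : -a ∈ Delta S := fun v hv => by
  have h := (ha (-v) hv.neg).neg
  rwa [show -(a + -v) = -a + v by abel] at h

theorem Delta.add_mem {a b : S} (ha : a ∈ Delta S) (hb : b ∈ Delta S) : a + b ∈ Delta S :=
  fun v hv => by
    rw [add_assoc]
    exact ha _ (hb v hv)

theorem Delta.sub_mem {a b : S} (ha : a ∈ Delta S) (hb : b ∈ Delta S) : a - b ∈ Delta S := by
  rw [sub_eq_add_neg]
  exact Delta.add_mem ha (Delta.neg_mem hb)

theorem Delta.mul_unit_mem {a u : S} (ha : a ∈ Delta S) (hu : IsUnit u) : a * u ∈ Delta S := by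
  obtain ⟨u, rfl⟩ := hu
  intro v hv
  have h := (ha (v * ↑u⁻¹) (hv.mul u⁻¹.isUnit)).mul u.isUnit
  rwa [add_mul, mul_assoc v, Units.inv_mul, mul_one] at h

theorem Delta.isUnit_add_one {a : S} (ha : a ∈ Delta S) : IsUnit (a + 1) := ha 1 isUnit_one

/-- ab = a(1 + b) - a, with 1 + b a unit. -/
theorem Delta.mul_mem {a b : S} (ha : a ∈ Delta S) (hb : b ∈ Delta S) : a * b ∈ Delta S := by
  have h := Delta.sub_mem (Delta.mul_unit_mem ha (Delta.isUnit_add_one hb)) ha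
  rwa [mul_add, mul_one, add_sub_cancel_right] at h

theorem Delta.isUnit_sub_one {a : S} (ha : a ∈ Delta S) : IsUnit (a - 1) := by
  rw [sub_eq_add_neg]
  exact ha _ isUnit_one.neg

theorem Delta.eq_zero_of_isIdempotentElem {e : S} (he : IsIdempotentElem e) (h : e ∈ Delta S) :
    e = 0 := by
  have he' : e * e = e := he
  refine (Delta.isUnit_sub_one h).mul_left_eq_zero.mp ?_
  rw [mul_sub, he', mul_one, sub_self]

/-- An element of `Δ(S)` is not invertible in the corner of a nonzero idempotent which it
commutes with. -/
theorem Delta.eq_zero_of_corner_inverse {d e s : S} (hd : d ∈ Delta S) (he : IsIdempotentElem e)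
    (hed : e * d = d * e) (hes : e * s = s) (hse : s * e = s) (hds : d * s = e) (hsd : s * d = e) :
    e = 0 := by
  have he' : e * e = e := he
  have h1 : (s + (1 - e)) * (d * e + (1 - e)) = 1 := by
    have : (s + (1 - e)) * (d * e + (1 - e))
        = s * d * e + (s - s * e) + (d * e - e * d * e) + (1 - e - e + e * e) := by noncomm_ring
    rw [this, hsd, hse, hed, mul_assoc d, he']; abel
  have h2 : (d * e + (1 - e)) * (s + (1 - e)) = 1 := by
    have : (d * e + (1 - e)) * (s + (1 - e))
        = d * (e * s) + (d * e - d * (e * e)) + (s - e * s) + (1 - e - e + e * e) := by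
      noncomm_ring
    rw [this, hes, hds, he']; abel
  -- With v = s + (1 - e), the element dv - 1 is a unit, yet e annihilates it.
  have hv : IsUnit (s + (1 - e)) := ⟨⟨_, _, h1, h2⟩, rfl⟩
  refine (Delta.isUnit_sub_one (Delta.mul_unit_mem hd hv)).mul_left_eq_zero.mp ?_
  have : e * (d * (s + (1 - e)) - 1) = e * (d * s) + (e * d - e * d * e) - e := by noncomm_ring
  rw [this, hds, hed, mul_assoc d, he']; abel

end Delta

/-- Every nonzero principal right ideal contains a nonzero idempotent. -/
def IsRightPotent (S : Type*) [Ring S] : Prop :=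
  ∀ x : S, x ≠ 0 → ∃ e s : S, IsIdempotentElem e ∧ e ≠ 0 ∧ e = x * s

/-! ### Potent WΔU-rings are reduced with units ±1. -/

section Potent

variable {S : Type*} [Ring S]

theorem IsRightPotent.natCast_eq_zero_of_mem_Delta (hP : IsRightPotent S) {n : ℕ}
    (hn : (n : S) ∈ Delta S) : (n : S) = 0 := by
  by_contra h
  obtain ⟨e, s, he, he0, hes⟩ := hP _ h
  have he' : e * e = e := he
  have hc : (n : S) * (e * s * e) = e := by
    rw [← mul_assoc, ← mul_assoc, (Nat.cast_commute n e).eq, mul_assoc e, ← hes, he', he']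
  refine he0 (Delta.eq_zero_of_corner_inverse (s := e * s * e) hn he
    (Nat.cast_commute n e).eq.symm ?_ ?_ hc ?_)
  · rw [← mul_assoc, ← mul_assoc, he']
  · rw [mul_assoc, he']
  · rw [← (Nat.cast_commute n _).eq, hc]

theorem mem_Delta_of_mul_self_eq_zero (hP : IsRightPotent S) (hW : IsWDeltaU S) {x : S}
    (hx : x * x = 0) : x ∈ Delta S := by
  have hu : IsUnit (1 + x) := by
    refine ⟨⟨1 + x, 1 - x, ?_, ?_⟩, rfl⟩
    · have : (1 + x) * (1 - x) = 1 - x * x := by noncomm_ring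
      rw [this, hx, sub_zero]
    · have : (1 - x) * (1 + x) = 1 - x * x := by noncomm_ring
      rw [this, hx, sub_zero]
  obtain ⟨d, hd, h | h⟩ : (1 + x) ∈ {x : S | ∃ d ∈ Delta S, x = 1 + d ∨ x = -1 + d} := hW ▸ hu
  · rwa [add_left_cancel h]
  -- Here d² = 4(1 + x), so 4 ∈ Δ and 4 = 0. Then (2 + v)² = v² puts 2 in Δ, so 2 = 0 and d = x.
  · have hd2 : d = 2 + x := by
      rw [show d = 1 + (-1 + d) by abel, ← h, ← one_add_one_eq_two]; abel
    subst hd2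
    obtain ⟨w, hw⟩ := hu
    have hsq : ((4 : ℕ) : S) * w ∈ Delta S := by
      have : (2 + x) * (2 + x) = ((4 : ℕ) : S) * w := by
        have : (2 + x) * (2 + x) = 2 * 2 + 4 * x + x * x := by noncomm_ring
        rw [this, hx, hw, mul_add]; norm_num
      rw [← this]
      exact Delta.mul_mem hd hd
    have h4 := Delta.mul_unit_mem hsq w⁻¹.isUnit
    rw [mul_assoc, Units.mul_inv, mul_one] at h4
    have h40 := hP.natCast_eq_zero_of_mem_Delta h4
    have h2 : ((2 : ℕ) : S) ∈ Delta S := by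
      intro v hv
      refine (isUnit_pow_iff (n := 2) two_ne_zero).mp ?_
      have : (((2 : ℕ) : S) + v) ^ 2 = v ^ 2 := by
        have : (((2 : ℕ) : S) + v) ^ 2 = ((4 : ℕ) : S) + ((4 : ℕ) : S) * v + v ^ 2 := by
          have h4' : (2 : S) * 2 = ((4 : ℕ) : S) := by norm_num
          rw [← h4', Nat.cast_ofNat, pow_two, pow_two]
          simp only [add_mul, mul_add, two_mul, mul_two]; abel
        rw [this, h40]; simp
      rw [this]
      exact hv.pow 2
    have h20 := hP.natCast_eq_zero_of_mem_Delta h2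
    push_cast at h20
    rwa [h20, zero_add] at hd

theorem eq_zero_of_mul_self_eq_zero (hP : IsRightPotent S) (hW : IsWDeltaU S) {x : S}
    (hx : x * x = 0) : x = 0 := by
  by_contra h
  obtain ⟨e, s, he, he0, hes⟩ := hP _ h
  have he' : e * e = e := he
  have hxe : x * e = 0 := by rw [hes, ← mul_assoc, hx, zero_mul]
  -- Factor e into two square-zero elements; both lie in Δ, hence so does e.
  have hyz : (e * x) * ((1 - e) * s * e) = e := by
    have : (e * x) * ((1 - e) * s * e) = e * (x * s) * e - e * (x * e) * s * e := by noncomm_ring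
    rw [this, hxe, ← hes, he', he']; simp
  have hy : (e * x) * (e * x) = 0 := by
    have : (e * x) * (e * x) = e * (x * e) * x := by noncomm_ring
    rw [this, hxe]; simp
  have hz : ((1 - e) * s * e) * ((1 - e) * s * e) = 0 := by
    have : ((1 - e) * s * e) * ((1 - e) * s * e) = (1 - e) * s * (e - e * e) * s * e := by
      noncomm_ring
    rw [this, he']; simp
  have hmem := Delta.mul_mem (mem_Delta_of_mul_self_eq_zero hP hW hy)
    (mem_Delta_of_mul_self_eq_zero hP hW hz)
  rw [hyz] at hmem
  exact he0 (Delta.eq_zero_of_isIdempotentElem he hmem)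

/-- ex(1 - e) and (1 - e)xe square to zero. -/
theorem IsIdempotentElem.central (hP : IsRightPotent S) (hW : IsWDeltaU S) {e : S}
    (he : IsIdempotentElem e) (x : S) : e * x = x * e := by
  have he' : e * e = e := he
  have h1 : e * x - e * x * e = 0 := by
    refine eq_zero_of_mul_self_eq_zero hP hW ?_
    have : (e * x - e * x * e) * (e * x - e * x * e)
        = e * x * (e - e * e) * x - e * x * (e - e * e) * x * e := by noncomm_ring
    rw [this, he']; simp
  have h2 : x * e - e * x * e = 0 := by
    refine eq_zero_of_mul_self_eq_zero hP hW ?_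
    have : (x * e - e * x * e) * (x * e - e * x * e)
        = x * (e - e * e) * x * e - e * x * (e - e * e) * x * e := by noncomm_ring
    rw [this, he']; simp
  rw [sub_eq_zero.mp h1, sub_eq_zero.mp h2]

/-- When idempotents are central, right divisors of an idempotent can be normalized to
two-sided inverses in its corner. -/
theorem exists_corner_inverse (hc : ∀ e : S, IsIdempotentElem e → ∀ x, e * x = x * e)
    {a s e : S} (he : IsIdempotentElem e) (hes : e = a * s) :
    ∃ t, e * t = t ∧ a * t = e ∧ t * a = e := by
  have he' : e * e = e := he
  refine ⟨s * e, ?_, ?_, ?_⟩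
  · rw [← mul_assoc, hc e he s, mul_assoc, he']
  · rw [← mul_assoc, ← hes, he']
  · have hf : IsIdempotentElem (s * e * a) := by
      have : s * e * a * (s * e * a) = s * e * (a * s) * e * a := by noncomm_ring
      rw [IsIdempotentElem, this, ← hes, mul_assoc s, he', mul_assoc s, he']
    have h1 : s * e * a * e = s * e * a := by
      rw [mul_assoc, ← hc e he a, ← mul_assoc, mul_assoc s, he']
    have h2 : s * e * a * e = e := by
      have : s * e * a * (a * s) = a * (s * e * a) * s := by rw [← mul_assoc, hc _ hf a]
      nth_rewrite 2 [hes]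
      rw [this]
      have : a * (s * e * a) * s = (a * s) * e * (a * s) := by noncomm_ring
      rw [this, ← hes, he', he']
    rw [← h1, h2]

theorem Delta.eq_zero (hP : IsRightPotent S) (hW : IsWDeltaU S) {d : S} (hd : d ∈ Delta S) :
    d = 0 := by
  by_contra h
  obtain ⟨e, s, he, he0, hes⟩ := hP _ h
  have hc := fun e (he : IsIdempotentElem e) => IsIdempotentElem.central hP hW he
  obtain ⟨t, h1, h2, h3⟩ := exists_corner_inverse hc he hes
  exact he0 (Delta.eq_zero_of_corner_inverse hd he (hc e he d) h1 (hc e he t ▸ h1) h2 h3)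

theorem eq_one_or_eq_neg_one_of_isUnit (hP : IsRightPotent S) (hW : IsWDeltaU S) {u : S}
    (hu : IsUnit u) : u = 1 ∨ u = -1 := by
  obtain ⟨d, hd, h⟩ : u ∈ {x : S | ∃ d ∈ Delta S, x = 1 + d ∨ x = -1 + d} := hW ▸ hu
  rwa [Delta.eq_zero hP hW hd, add_zero, add_zero] at h

theorem IsRegularRing.isRightPotent (hS : IsRegularRing S) : IsRightPotent S := by
  intro x hx
  obtain ⟨y, hy⟩ := hS x
  refine ⟨x * y, y, ?_, ?_, rfl⟩
  · rw [IsIdempotentElem, ← mul_assoc, hy]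
  · rintro h
    rw [h, zero_mul] at hy
    exact hx hy.symm

theorem IsRegularRing.isExchangeRing (hS : IsRegularRing S)
    (hc : ∀ e : S, IsIdempotentElem e → ∀ x, e * x = x * e) : IsExchangeRing S := by
  intro a
  obtain ⟨x, hx⟩ := hS a
  have he : IsIdempotentElem (a * x) := by rw [IsIdempotentElem, ← mul_assoc, hx]
  refine ⟨a * x, he, ⟨x, rfl⟩, 1 - a * x, ?_⟩
  rw [sub_mul, one_mul, mul_sub a, mul_one, ← hc _ he a, hx, sub_self, sub_zero]

theorem IsExchangeRing.eq_neg_or_eq_two_sub (hS : IsExchangeRing S) (hP : IsRightPotent S)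
    (hW : IsWDeltaU S) (a : S) :
    ∃ e : S, IsIdempotentElem e ∧ (∃ r, e = a * r) ∧ (a = -e ∨ a = 2 - e) := by
  have hc := fun e (he : IsIdempotentElem e) => IsIdempotentElem.central hP hW he
  obtain ⟨e, he, ⟨r, hr⟩, s, hs⟩ := hS a
  have he' : e * e = e := he
  obtain ⟨t, ht1, ht2, ht3⟩ := exists_corner_inverse hc he hr
  obtain ⟨v, hv1, hv2, hv3⟩ := exists_corner_inverse hc he.one_sub hs
  have hev : e * v = 0 := by
    rw [← hv1, ← mul_assoc, mul_sub, he', mul_one, sub_self, zero_mul]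
  have hte : t * e = t := by rw [← hc e he t, ht1]
  have hve : v * e = 0 := by rw [← hc e he v, hev]
  have hae := hc e he a
  -- a - (1 - e) acts as a on eS and as -(1 - a) on (1 - e)S, so it is a unit, hence ±1.
  have h1 : (a - (1 - e)) * (t - v) = 1 := by
    have : (a - (1 - e)) * (t - v)
        = a * t + (1 - a) * v - (t - e * t) - e * v := by noncomm_ring
    rw [this, ht1, ht2, hv2, hev]; abel
  have h2 : (t - v) * (a - (1 - e)) = 1 := by
    have : (t - v) * (a - (1 - e))
        = t * a + v * (1 - a) - (t - t * e) - v * e := by noncomm_ring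
    rw [this, hte, ht3, hv3, hve]; abel
  refine ⟨e, he, ⟨r, hr⟩, ?_⟩
  rcases eq_one_or_eq_neg_one_of_isUnit hP hW (u := a - (1 - e)) ⟨⟨_, _, h1, h2⟩, rfl⟩ with h | h
  · right
    rw [show a = (a - (1 - e)) + (1 - e) by abel, h, ← one_add_one_eq_two]; abel
  · left
    rw [show a = (a - (1 - e)) + (1 - e) by abel, h]; abel

/-- Decomposing 3 gives 12 = 0, so 6² = 0, and the ring is reduced. -/
theorem IsExchangeRing.six_eq_zero (hS : IsExchangeRing S) (hP : IsRightPotent S)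
    (hW : IsWDeltaU S) : (6 : S) = 0 := by
  have h12 : (12 : S) = 0 := by
    obtain ⟨e, he, -, h | h⟩ := hS.eq_neg_or_eq_two_sub hP hW 3
    · have he' : e * e = e := he
      obtain rfl : e = -3 := by rw [h, neg_neg]
      have : (12 : S) = (-3) * (-3) - (-3) := by norm_num
      rw [this, he', sub_self]
    · have he' : e * e = e := he
      obtain rfl : e = -1 := by
        rw [show e = 2 - (2 - e) by abel, ← h]; norm_num
      have h2 : (2 : S) = (-1) * (-1) - (-1) := by norm_num
      rw [he', sub_self] at h2
      rw [show (12 : S) = 6 * 2 by norm_num, h2, mul_zero]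
  refine eq_zero_of_mul_self_eq_zero hP hW ?_
  rw [show (6 : S) * 6 = 3 * 12 by norm_num, h12, mul_zero]

theorem IsExchangeRing.isWeaklyBoolean (hS : IsExchangeRing S) (hP : IsRightPotent S)
    (hW : IsWDeltaU S) : IsWeaklyBoolean S := by
  intro a
  obtain ⟨e, he, -, h | h⟩ := hS.eq_neg_or_eq_two_sub hP hW a
  · right
    rwa [h, neg_neg]
  have he' : e * e = e := he
  rcases eq_one_or_eq_neg_one_of_isUnit hP hW (IsIdempotentElem.isUnit_one_sub_two_mul he)
    with h1 | h1
  · right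
    have h2e : 2 * e = 0 := by
      rw [show 2 * e = 1 - (1 - 2 * e) by abel, h1, sub_self]
    have h6 := hS.six_eq_zero hP hW
    have key : -a * -a - -a = 2 * 2 + 2 - 2 * (2 * e) + (e * e - e) := by
      rw [h]; noncomm_ring
    rw [h2e, show (2 : S) * 2 + 2 = 6 by norm_num, h6, he'] at key
    exact sub_eq_zero.mp (by simpa using key)
  · left
    have h2e : 2 * e = 2 := by
      rw [show 2 * e = 1 - (1 - 2 * e) by abel, h1]; norm_num
    have : a = e := by rw [h, ← h2e, two_mul, add_sub_cancel_right]
    rwa [this]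

end Potent

/-! ### Transfer between R and R/J(R). -/

section Jacobson

variable {R : Type*} [Ring R]

theorem isUnit_one_add_of_mem_jacobson {r : R} (hr : r ∈ Ring.jacobson R) : IsUnit (1 + r) := by
  have key : ∀ x ∈ Ring.jacobson R, ∃ z, z * (1 + x) = 1 := fun x hx => by
    rw [← Ideal.jacobson_bot, Ideal.mem_jacobson_iff] at hx
    obtain ⟨z, hz⟩ := hx 1
    refine ⟨z, ?_⟩
    rw [Ideal.mem_bot, mul_one, sub_eq_zero] at hz
    rw [mul_add, mul_one, add_comm, hz]
  obtain ⟨z, hz⟩ := key r hr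
  -- z = 1 - zr is again in 1 + J, so it too has a left inverse.
  obtain ⟨w, hw⟩ := key (-(z * r)) (neg_mem (Ideal.mul_mem_left _ _ hr))
  have hz' : 1 + -(z * r) = z := by
    rw [← hz]; noncomm_ring
  rw [hz'] at hw
  have : w = 1 + r := left_inv_eq_right_inv hw hz
  exact ⟨⟨1 + r, z, this ▸ hw, hz⟩, rfl⟩

theorem mem_jacobson_of_forall_isUnit {x : R} (hx : ∀ y, IsUnit (1 - x * y)) :
    x ∈ Ring.jacobson R := by
  rw [← Ideal.jacobson_bot, Ideal.mem_jacobson_iff]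
  intro y
  obtain ⟨u, hu⟩ := hx (-y)
  refine ⟨1 - y * ↑u⁻¹ * x, ?_⟩
  have h : (u⁻¹ : Rˣ) * (1 + x * y) = (1 : R) := by
    rw [show 1 + x * y = u by rw [hu]; noncomm_ring, u.inv_mul]
  have : (1 - y * ↑u⁻¹ * x) * y * x + (1 - y * ↑u⁻¹ * x) - 1
      = y * (1 - ↑u⁻¹ * (1 + x * y)) * x := by noncomm_ring
  rw [Ideal.mem_bot, this, h]; simp

local notation "π" => Ideal.Quotient.mk (Ring.jacobson R)

theorem mk_eq_mk_iff {a b : R} : π a = π b ↔ a - b ∈ Ring.jacobson R := Ideal.Quotient.eq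

theorem isUnit_of_mk_eq {u v : R} (hv : IsUnit v) (h : π u = π v) : IsUnit u := by
  obtain ⟨v, rfl⟩ := hv
  rw [mk_eq_mk_iff] at h
  have := v.isUnit.mul (isUnit_one_add_of_mem_jacobson (Ideal.mul_mem_left _ (↑v⁻¹ : R) h))
  rwa [mul_add, mul_one, ← mul_assoc, Units.mul_inv, one_mul, add_sub_cancel] at this

theorem isUnit_mk_iff {u : R} : IsUnit (π u) ↔ IsUnit u := by
  refine ⟨fun h => ?_, fun h => h.map _⟩
  obtain ⟨v, hv⟩ := Ideal.Quotient.mk_surjective (↑h.unit⁻¹ : R ⧸ Ring.jacobson R)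
  have h1 : IsUnit (u * v) := isUnit_of_mk_eq isUnit_one (by
    rw [map_mul, hv, map_one]; exact h.mul_val_inv)
  have h2 : IsUnit (v * u) := isUnit_of_mk_eq isUnit_one (by
    rw [map_mul, hv, map_one]; exact h.val_inv_mul)
  obtain ⟨a, ha⟩ := h1.exists_right_inv
  obtain ⟨b, hb⟩ := h2.exists_left_inv
  rw [mul_assoc] at ha
  rw [← mul_assoc] at hb
  exact ⟨⟨u, v * a, ha, left_inv_eq_right_inv hb ha ▸ hb⟩, rfl⟩

theorem mk_mem_Delta {d : R} (hd : d ∈ Delta R) : π d ∈ Delta (R ⧸ Ring.jacobson R) := by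
  intro v hv
  obtain ⟨v, rfl⟩ := Ideal.Quotient.mk_surjective v
  rw [← map_add, isUnit_mk_iff]
  exact hd v (isUnit_mk_iff.mp hv)

theorem mem_Delta_of_mem_jacobson {d : R} (hd : d ∈ Ring.jacobson R) : d ∈ Delta R := fun v hv =>
  isUnit_of_mk_eq hv (by rwa [mk_eq_mk_iff, add_sub_cancel_right])

theorem isWDeltaU_iff :
    IsWDeltaU R ↔ ∀ u : R, IsUnit u → ∃ d ∈ Delta R, u = 1 + d ∨ u = -1 + d := by
  refine ⟨fun h u hu => ?_, fun h => Set.Subset.antisymm h ?_⟩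
  · have : u ∈ {x : R | IsUnit x} := hu
    rwa [h] at this
  · rintro u ⟨d, hd, rfl | rfl⟩
    · exact add_comm d 1 ▸ hd 1 isUnit_one
    · exact add_comm d (-1) ▸ hd (-1) isUnit_one.neg

theorem IsWDeltaU.quotient_jacobson (hW : IsWDeltaU R) : IsWDeltaU (R ⧸ Ring.jacobson R) := by
  rw [isWDeltaU_iff] at hW ⊢
  intro u hu
  obtain ⟨u, rfl⟩ := Ideal.Quotient.mk_surjective u
  obtain ⟨d, hd, h⟩ := hW u (isUnit_mk_iff.mp hu)
  refine ⟨π d, mk_mem_Delta hd, h.imp ?_ ?_⟩ <;> rintro rfl <;> simp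

theorem IsExchangeRing.quotient_jacobson (hE : IsExchangeRing R) :
    IsExchangeRing (R ⧸ Ring.jacobson R) := by
  intro a
  obtain ⟨a, rfl⟩ := Ideal.Quotient.mk_surjective a
  obtain ⟨e, he, ⟨r, hr⟩, s, hs⟩ := hE a
  refine ⟨π e, he.map π, ⟨π r, by rw [hr, map_mul]⟩, π s, ?_⟩
  rw [← map_one π, ← map_sub, ← map_sub, ← map_mul, hs]

theorem IsExchangeRing.exists_idempotent_of_notMem_jacobson (hE : IsExchangeRing R) {x : R}
    (hx : x ∉ Ring.jacobson R) : ∃ e s : R, IsIdempotentElem e ∧ e ≠ 0 ∧ e = x * s := by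
  by_contra! hcon
  refine hx (mem_jacobson_of_forall_isUnit ?_)
  have key : ∀ y, ∃ s, (1 - x * y) * s = 1 := fun y => by
    obtain ⟨e, he, ⟨r, hr⟩, s, hs⟩ := hE (x * y)
    have he0 : e = 0 := by
      by_contra h
      exact hcon e (y * r) he h (by rw [hr, mul_assoc])
    exact ⟨s, by rw [← hs, he0, sub_zero]⟩
  intro y
  obtain ⟨s, hs⟩ := key y
  -- The right inverse s = 1 + xys has the same form, so it is itself right invertible.
  obtain ⟨t, ht⟩ := key (-(y * s))
  have hs' : 1 - x * -(y * s) = s := by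
    have : 1 - x * -(y * s) = (1 - x * y) * s + x * y * s := by rw [hs]; noncomm_ring
    rw [this]; noncomm_ring
  rw [hs'] at ht
  exact ⟨⟨1 - x * y, s, hs, left_inv_eq_right_inv hs ht ▸ ht⟩, rfl⟩

theorem IsExchangeRing.isRightPotent_quotient_jacobson (hE : IsExchangeRing R) :
    IsRightPotent (R ⧸ Ring.jacobson R) := by
  intro x hx
  have : x ∉ Ring.jacobson (R ⧸ Ring.jacobson R) := by
    rwa [Ring.jacobson_quotient_jacobson, Submodule.mem_bot]
  exact hE.quotient_jacobson.exists_idempotent_of_notMem_jacobson this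

theorem IsExchangeRing.idempotentsLift (hE : IsExchangeRing R) :
    IdempotentsLiftModJacobson R := by
  intro x hx
  have hx' : x * x = x := hx
  obtain ⟨a, rfl⟩ := Ideal.Quotient.mk_surjective x
  obtain ⟨e, he, ⟨r, hr⟩, s, hs⟩ := hE a
  refine ⟨e, he, ?_⟩
  have h1 : π a * π e = π e := by
    rw [hr, map_mul, ← mul_assoc, hx']
  have h2 : π a * (1 - π e) = 0 := by
    rw [← map_one π, ← map_sub, hs, map_mul, map_sub, map_one, ← mul_assoc, mul_sub, hx', mul_one,
      sub_self, zero_mul]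
  rw [mul_sub, mul_one, sub_eq_zero] at h2
  rw [h2, h1]

theorem IsExchangeRing.of_quotient_jacobson (hE : IsExchangeRing (R ⧸ Ring.jacobson R))
    (hL : IdempotentsLiftModJacobson R) : IsExchangeRing R := by
  intro a
  obtain ⟨x, hx, ⟨r, hr⟩, s, hs⟩ := hE (π a)
  obtain ⟨r, rfl⟩ := Ideal.Quotient.mk_surjective r
  obtain ⟨s, rfl⟩ := Ideal.Quotient.mk_surjective s
  obtain ⟨f, hf, rfl⟩ := hL x hx
  have hf' : f * f = f := hf
  -- Conjugating `f` by `u` moves it into `aR` without changing its class.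
  obtain ⟨u, hu⟩ : IsUnit (1 - f + a * r) := isUnit_of_mk_eq isUnit_one (by
    rw [map_add, map_sub, map_mul, ← hr, map_one, sub_add_cancel])
  have huf : (u : R) * f = a * r * f := by
    rw [hu, add_mul, sub_mul, one_mul, hf', sub_self, zero_add]
  have hu1 : π (u : R) = 1 := by
    rw [hu, map_add, map_sub, map_mul, ← hr, map_one, sub_add_cancel]
  obtain ⟨e, he⟩ : ∃ e, e = (u : R) * f * ↑u⁻¹ := ⟨_, rfl⟩
  have he' : e * e = e := by
    have : e * e = (u : R) * f * (↑u⁻¹ * u) * f * ↑u⁻¹ := by rw [he]; noncomm_ring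
    rw [this, u.inv_mul, mul_one, mul_assoc (u : R) f f, hf', he]
  have hea : e = a * (r * f * ↑u⁻¹) := by rw [he, huf]; simp only [mul_assoc]
  have hef : π e = π f := by
    have h : e * u = u * f := by rw [he, mul_assoc, u.inv_mul, mul_one]
    have := congrArg π h
    rwa [map_mul, map_mul, hu1, mul_one, one_mul] at this
  obtain ⟨w, hw⟩ : IsUnit (e + (1 - a) * s) := isUnit_of_mk_eq isUnit_one (by
    rw [map_add, map_mul, map_sub, map_one, ← hs, hef, add_sub_cancel])
  have hw1 : 1 - e * ↑w⁻¹ = (1 - a) * (s * ↑w⁻¹) := by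
    have : (e + (1 - a) * s) * ↑w⁻¹ = 1 := by rw [← hw, w.mul_inv]
    rw [← mul_assoc, eq_comm, eq_sub_iff_add_eq', ← add_mul, this]
  -- ew⁻¹ need not be idempotent; this element is, and its complement (1 - ew⁻¹)(1 - e) stays in (1
  -- - a)R.
  refine ⟨e + e * ↑w⁻¹ * (1 - e), ?_, ⟨r * f * ↑u⁻¹ * (1 + ↑w⁻¹ * (1 - e)), ?_⟩,
    s * ↑w⁻¹ * (1 - e), ?_⟩
  · have : (e + e * ↑w⁻¹ * (1 - e)) * (e + e * ↑w⁻¹ * (1 - e))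
        = e * e + e * e * ↑w⁻¹ * (1 - e) + e * ↑w⁻¹ * (e - e * e)
          + e * ↑w⁻¹ * (e - e * e) * ↑w⁻¹ * (1 - e) := by noncomm_ring
    rw [IsIdempotentElem, this, he']; simp
  · rw [← mul_assoc, ← hea]; noncomm_ring
  · rw [← mul_assoc, ← hw1]; noncomm_ring

theorem IsWeaklyBoolean.isRegularRing {S : Type*} [Ring S] (hS : IsWeaklyBoolean S) :
    IsRegularRing S := by
  intro a
  refine ⟨a, ?_⟩
  rcases hS a with h | h
  · have h' : a * a = a := h
    rw [h', h']
  · have h' : a * a = -a := by rw [← neg_mul_neg]; exact h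
    rw [h', neg_mul, h', neg_neg]

theorem IsWeaklyBoolean.isExchangeRing {S : Type*} [Ring S] (hS : IsWeaklyBoolean S) :
    IsExchangeRing S := by
  intro a
  rcases hS a with h | h
  · exact ⟨a, h, ⟨1, (mul_one a).symm⟩, 1, (mul_one _).symm⟩
  · have h' : a * a = -a := by rw [← neg_mul_neg]; exact h
    refine ⟨-a, h, ⟨-1, by simp⟩, 1 + a, ?_⟩
    have : (1 - a) * (1 + a) = 1 - a * a := by noncomm_ring
    rw [this, h']

theorem IsSemiWeaklyBoolean.isWDeltaU (h : IsSemiWeaklyBoolean R) : IsWDeltaU R := by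
  rw [isWDeltaU_iff]
  intro u hu
  have hcancel : ∀ v : R ⧸ Ring.jacobson R, IsUnit v → IsIdempotentElem v → v = 1 :=
    fun v hv hi => hv.mul_left_cancel (by rw [mul_one]; exact hi)
  rcases h.1 (π u) with hi | hi
  · have h1 := hcancel _ (hu.map π) hi
    rw [← map_one π, mk_eq_mk_iff] at h1
    exact ⟨u - 1, mem_Delta_of_mem_jacobson h1, Or.inl (by abel)⟩
  · have h1 := hcancel _ (hu.map π).neg hi
    rw [← map_neg, ← map_one π, mk_eq_mk_iff] at h1
    refine ⟨u + 1, mem_Delta_of_mem_jacobson ?_, Or.inr (by abel)⟩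
    have := neg_mem h1
    rwa [show -(-u - 1) = u + 1 by abel] at this

end Jacobson

end WDU

theorem mainTheorem2 {R : Type*} [Ring R] :
    List.TFAE
      [WDU.IsSemiregularRing R ∧ WDU.IsWDeltaU R,
       WDU.IsExchangeRing R ∧ WDU.IsWDeltaU R,
       WDU.IsSemiWeaklyBoolean R] := by
  tfae_have 1 → 3 := fun ⟨⟨hR, hL⟩, hW⟩ => by
    have hP := hR.isRightPotent
    have hW' := hW.quotient_jacobson
    exact ⟨(hR.isExchangeRing fun e he =>
      WDU.IsIdempotentElem.central hP hW' he).isWeaklyBoolean hP hW', hL⟩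
  tfae_have 2 → 3 := fun ⟨hE, hW⟩ =>
    ⟨hE.quotient_jacobson.isWeaklyBoolean hE.isRightPotent_quotient_jacobson hW.quotient_jacobson,
      hE.idempotentsLift⟩
  tfae_have 3 → 1 := fun h => ⟨⟨h.1.isRegularRing, h.2⟩, h.isWDeltaU⟩
  tfae_have 3 → 2 := fun h =>
    ⟨WDU.IsExchangeRing.of_quotient_jacobson h.1.isExchangeRing h.2, h.isWDeltaU⟩
  tfae_finish
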